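/- Let $\mathbb{F}$ be a field of characteristic not $2$ and let $s$ be a symplectic form (a nondegenerate alternating bilinear form) on a finite-dimensional $\mathbb{F}$-vector space $V$, with symplectic group $\mathrm{Sp}(s)$. A Lagrangian is a totally $s$-singular subspace of dimension $\frac12\dim V$. If $\mathcal{L},\mathcal{L}'$ are Lagrangians with $\mathcal{L}\cap\mathcal{L}'=\{0\}$ and $v\in\mathrm{GL}(\mathcal{L})$, the symplectic extension of $v$ to $\mathcal{L}'$ is the element $v\oplus v'$ of $\mathrm{Sp}(s)$ with respect to $V=\mathcal{L}\oplus\mathcal{L}'$, where $v'=\varphi^{-1}\circ (v^{-1})^t\circ\varphi$, $\varphi:\mathcal{L}'\to\mathcal{L}^\star$ is the isomorphism $x\mapsto s(-,x)$, and $(v^{-1})^t$ is the map $f\mapsto f\circ v^{-1}$ on $\mathcal{L}^\star$. Let $u\in\mathrm{Sp}(s)$ be the symplectic extension, to some Lagrangian $\mathcal{L}'$ with $\mathcal{L}\cap\mathcal{L}'=\{0\}$, of an automorphism $v$ of a Lagrangian $\mathcal{L}$. Assume that $v$ is cyclic (some vector $x\in\mathcal{L}$ is such that the vectors $v^k(x)$,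 $k\geq 0$, span $\mathcal{L}$), and that its minimal polynomial $p$ is even, i.e. $p(-t)=p(t)$, and relatively prime with its reciprocal polynomial $p^\sharp(t)=p(0)^{-1}t^{\deg p}\,p(t^{-1})$. Then there are $i_1,i_2,i_3\in\mathrm{Sp}(s)$ with $i_1^2=i_2^2=i_3^2=\mathrm{id}$ and $u=i_1i_2i_3$. -/

import Mathlib

noncomputable section

/-- An element `g` of a group is `k`-reflectional if it is the product of `k` involutions,
where an involution is an element of order `1` or `2`, i.e. an element with square `1`. -/
def IsReflectional {G : Type*} [Group G] (k : ℕ) (g : G) : Prop :=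
  ∃ l : List G, l.length = k ∧ (∀ i ∈ l, i * i = 1) ∧ l.prod = g

/-- The reciprocal polynomial `p(0)⁻¹ t^d p(t⁻¹)` of a polynomial `p` of degree `d`
(with `p(0) ≠ 0`). -/
def reciprocalPoly {F : Type*} [Field F] (p : Polynomial F) : Polynomial F :=
  Polynomial.C (p.eval 0)⁻¹ * p.reverse

/-- A polynomial is even if `p(-t) = p(t)`. -/
def IsEvenPoly {F : Type*} [Field F] (p : Polynomial F) : Prop :=
  p.comp (-Polynomial.X) = p

/-- An endomorphism `f` of a vector space is cyclic if some vector `x` is such that the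
`f ^ k x`, `k ≥ 0`, span the whole space. -/
def IsCyclicEnd {F W : Type*} [Field F] [AddCommGroup W] [Module F W]
    (f : Module.End F W) : Prop :=
  ∃ x : W, Submodule.span F (Set.range fun k : ℕ => (f ^ k) x) = ⊤

/-- A symplectic form: a nondegenerate alternating bilinear form. -/
structure IsSymplecticForm {F V : Type*} [Field F] [AddCommGroup V] [Module F V]
    (s : LinearMap.BilinForm F V) : Prop where
  alt : s.IsAlt
  nondegenerate : s.Nondegenerate

/-- The group `Sp(s)` of all automorphisms of the vector space that preserve `s`. -/
def Sp {F V : Type*} [Field F] [AddCommGroup V] [Module F V]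
    (s : LinearMap.BilinForm F V) : Subgroup (V ≃ₗ[F] V) where
  carrier := {u | ∀ x y, s (u x) (u y) = s x y}
  one_mem' := fun _ _ => rfl
  mul_mem' := by
    intro a b ha hb x y
    rw [LinearEquiv.mul_apply, LinearEquiv.mul_apply, ha, hb]
  inv_mem' := by
    intro a ha x y
    have h := ha (a⁻¹ x) (a⁻¹ y)
    have e : ∀ z, a (a⁻¹ z) = z := fun z => a.apply_symm_apply z
    rw [e, e] at h
    exact h.symm

/-- A Lagrangian: a totally `s`-singular subspace whose dimension is half that of the
ambient space. -/
structure IsLagrangian {F V : Type*} [Field F] [AddCommGroup V] [Module F V]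
    (s : LinearMap.BilinForm F V) (L : Submodule F V) : Prop where
  singular : ∀ x ∈ L, ∀ y ∈ L, s x y = 0
  finrank_eq : 2 * Module.finrank F L = Module.finrank F V

/-- Transverse Lagrangians are complementary. -/
theorem IsLagrangian.isCompl {F V : Type*} [Field F] [AddCommGroup V] [Module F V]
    [FiniteDimensional F V] {s : LinearMap.BilinForm F V} {L L' : Submodule F V}
    (hL : IsLagrangian s L) (hL' : IsLagrangian s L') (h : L ⊓ L' = ⊥) : IsCompl L L' := by
  have h1 := hL.finrank_eq
  have h2 := hL'.finrank_eq
  have h3 := Submodule.finrank_sup_add_finrank_inf_eq L L'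
  rw [h, finrank_bot] at h3
  refine ⟨disjoint_iff.mpr h, codisjoint_iff.mpr ?_⟩
  apply Submodule.eq_top_of_finrank_eq
  omega

/-- The linear map `L' → L⋆`, `x ↦ s(-, x)`. -/
def toDualLagrangianMap {F V : Type*} [Field F] [AddCommGroup V] [Module F V]
    (s : LinearMap.BilinForm F V) (L L' : Submodule F V) : L' →ₗ[F] Module.Dual F L :=
  L.dualRestrict ∘ₗ LinearMap.flip s ∘ₗ L'.subtype

theorem toDualLagrangianMap_bijective {F V : Type*} [Field F] [AddCommGroup V] [Module F V]
    [FiniteDimensional F V] {s : LinearMap.BilinForm F V} {L L' : Submodule F V}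
    (hs : IsSymplecticForm s) (hL : IsLagrangian s L) (hL' : IsLagrangian s L')
    (h : L ⊓ L' = ⊥) : Function.Bijective (toDualLagrangianMap s L L') := by
  have hinj : Function.Injective (toDualLagrangianMap s L L') := by
    rw [← LinearMap.ker_eq_bot, LinearMap.ker_eq_bot']
    intro x hx
    have hx' : ∀ w ∈ L, s w x = 0 := fun w hw => LinearMap.congr_fun hx ⟨w, hw⟩
    have : (x : V) = 0 := by
      apply hs.nondegenerate.2
      intro y
      have hy : y ∈ L ⊔ L' := by
        rw [(hL.isCompl hL' h).sup_eq_top]; exact Submodule.mem_top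
      obtain ⟨a, ha, b, hb, rfl⟩ := Submodule.mem_sup.mp hy
      rw [map_add, LinearMap.add_apply, hx' a ha, hL'.singular b hb x x.2, add_zero]
    exact Subtype.ext this
  have h1 := hL.finrank_eq
  have h2 := hL'.finrank_eq
  have hd : Module.finrank F L' = Module.finrank F (Module.Dual F L) := by
    rw [Subspace.dual_finrank_eq]; omega
  exact ⟨hinj, (LinearMap.injective_iff_surjective_of_finrank_eq_finrank hd).mp hinj⟩

/-- The isomorphism `φ : L' ≃ L⋆`, `x ↦ s(-, x)`, for transverse Lagrangians `L`, `L'`. -/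
def toDualLagrangian {F V : Type*} [Field F] [AddCommGroup V] [Module F V]
    [FiniteDimensional F V] {s : LinearMap.BilinForm F V} {L L' : Submodule F V}
    (hs : IsSymplecticForm s) (hL : IsLagrangian s L) (hL' : IsLagrangian s L')
    (h : L ⊓ L' = ⊥) : L' ≃ₗ[F] Module.Dual F L :=
  LinearEquiv.ofBijective (toDualLagrangianMap s L L')
    (toDualLagrangianMap_bijective hs hL hL' h)

/-- The automorphism `v' = φ⁻¹ ∘ (v⁻¹)ᵗ ∘ φ` of `L'`, where `φ : L' ≃ L⋆`, `x ↦ s(-, x)`. -/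
def contragredient {F V : Type*} [Field F] [AddCommGroup V] [Module F V]
    [FiniteDimensional F V] {s : LinearMap.BilinForm F V} {L L' : Submodule F V}
    (hs : IsSymplecticForm s) (hL : IsLagrangian s L) (hL' : IsLagrangian s L')
    (h : L ⊓ L' = ⊥) (v : L ≃ₗ[F] L) : L' ≃ₗ[F] L' :=
  toDualLagrangian hs hL hL' h ≪≫ₗ v.symm.dualMap ≪≫ₗ (toDualLagrangian hs hL hL' h).symm

/-- The automorphism `v ⊕ v'` of `V = L ⊕ L'`. -/
def symplecticExtensionEquiv {F V : Type*} [Field F] [AddCommGroup V] [Module F V]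
    [FiniteDimensional F V] {s : LinearMap.BilinForm F V} {L L' : Submodule F V}
    (hs : IsSymplecticForm s) (hL : IsLagrangian s L) (hL' : IsLagrangian s L')
    (h : L ⊓ L' = ⊥) (v : L ≃ₗ[F] L) : V ≃ₗ[F] V :=
  (Submodule.prodEquivOfIsCompl L L' (hL.isCompl hL' h)).symm ≪≫ₗ
    (v.prodCongr (contragredient hs hL hL' h v)) ≪≫ₗ
      Submodule.prodEquivOfIsCompl L L' (hL.isCompl hL' h)

theorem symplecticExtensionEquiv_apply {F V : Type*} [Field F] [AddCommGroup V] [Module F V]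
    [FiniteDimensional F V] {s : LinearMap.BilinForm F V} {L L' : Submodule F V}
    (hs : IsSymplecticForm s) (hL : IsLagrangian s L) (hL' : IsLagrangian s L')
    (h : L ⊓ L' = ⊥) (v : L ≃ₗ[F] L) (a : L) (b : L') :
    symplecticExtensionEquiv hs hL hL' h v (a + b) =
      v a + contragredient hs hL hL' h v b := by
  have e : (a + b : V) = Submodule.prodEquivOfIsCompl L L' (hL.isCompl hL' h) (a, b) := by
    simp
  rw [e, symplecticExtensionEquiv, LinearEquiv.trans_apply, LinearEquiv.trans_apply,
    LinearEquiv.symm_apply_apply]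
  simp

theorem contragredient_pairing {F V : Type*} [Field F] [AddCommGroup V] [Module F V]
    [FiniteDimensional F V] {s : LinearMap.BilinForm F V} {L L' : Submodule F V}
    (hs : IsSymplecticForm s) (hL : IsLagrangian s L) (hL' : IsLagrangian s L')
    (h : L ⊓ L' = ⊥) (v : L ≃ₗ[F] L) (a : L) (b : L') :
    s (v a) (contragredient hs hL hL' h v b) = s a b := by
  have e : toDualLagrangian hs hL hL' h (contragredient hs hL hL' h v b) =
      v.symm.dualMap (toDualLagrangian hs hL hL' h b) := by
    simp [contragredient]
  have e' := LinearMap.congr_fun e (v a)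
  rw [LinearEquiv.dualMap_apply, LinearEquiv.symm_apply_apply] at e'
  exact e'

theorem symplecticExtensionEquiv_mem {F V : Type*} [Field F] [AddCommGroup V] [Module F V]
    [FiniteDimensional F V] {s : LinearMap.BilinForm F V} {L L' : Submodule F V}
    (hs : IsSymplecticForm s) (hL : IsLagrangian s L) (hL' : IsLagrangian s L')
    (h : L ⊓ L' = ⊥) (v : L ≃ₗ[F] L) : symplecticExtensionEquiv hs hL hL' h v ∈ Sp s := by
  intro x y
  have hx : ∀ x : V, ∃ (a : L) (b : L'), (a + b : V) = x := by
    intro x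
    have hx : x ∈ L ⊔ L' := by
      rw [(hL.isCompl hL' h).sup_eq_top]; exact Submodule.mem_top
    obtain ⟨a, ha, b, hb, e⟩ := Submodule.mem_sup.mp hx
    exact ⟨⟨a, ha⟩, ⟨b, hb⟩, e⟩
  obtain ⟨a, b, rfl⟩ := hx x
  obtain ⟨c, d, rfl⟩ := hx y
  have hsw : ∀ x y, s x y = - s y x := fun x y => (hs.alt.neg_eq y x).symm
  rw [symplecticExtensionEquiv_apply, symplecticExtensionEquiv_apply]
  simp only [map_add, LinearMap.add_apply]
  rw [hL.singular _ (v a).2 _ (v c).2, hL.singular _ a.2 _ c.2,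
    hL'.singular _ (contragredient hs hL hL' h v b).2 _ (contragredient hs hL hL' h v d).2,
    hL'.singular _ b.2 _ d.2, contragredient_pairing,
    hsw (contragredient hs hL hL' h v b) (v c), contragredient_pairing, hsw b c]

/-- The symplectic extension of `v ∈ GL(L)` to the transverse Lagrangian `L'`, as an element
of `Sp(s)`. -/
def symplecticExtension {F V : Type*} [Field F] [AddCommGroup V] [Module F V]
    [FiniteDimensional F V] {s : LinearMap.BilinForm F V} {L L' : Submodule F V}
    (hs : IsSymplecticForm s) (hL : IsLagrangian s L) (hL' : IsLagrangian s L')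
    (h : L ⊓ L' = ⊥) (v : L ≃ₗ[F] L) : Sp s :=
  ⟨symplecticExtensionEquiv hs hL hL' h v, symplecticExtensionEquiv_mem hs hL hL' h v⟩

end

open Matrix MatrixGroups Polynomial

/-! Let `R` be the commutative algebra generated by `v ^ 2`, and let `a` stand for `v ^ 2` in it. As
`p` is even, a cyclic vector `e` gives `L = R e ⊕ v R e`. A linear form on `L` that vanishes on `v R
e` and induces a nondegenerate trace form on `R` identifies the dual of `L`, hence `L'`, with two
further copies of `R`. So `V` becomes an orthogonal sum of two copies of the symplectic plane `R²`,
on which `u (x, y) = (D y, x)` with `D = diag(a, a⁻¹)` (`exists_equiv_of_functional`).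

Each `m` in `SL₂(R)` yields the symplectic involution `(x, y) ↦ (m⁻¹ y, m x)`. Three of them compose
to `(x, y) ↦ (D y, x)` once `D = g⁻¹ k g k⁻¹` (`isReflectional_three_of_equiv`). Such `g`, `k` exist
if `a ^ 2 - 1` is a unit (`exists_commutator_eq_diag`), that is, if `v ^ 4 - 1` is invertible; this
is where coprimality with the reciprocal polynomial enters (`isCoprime_X_pow_four_sub_one`). -/

/-! ### Commutators in `SL₂(R)`. -/

/-- The equation says that `k` conjugates `g` to `g * d`, where `d` is the diagonal matrix. The
chosen `g` has the same trace `(a + 1) * w` as `g * d`, for every `w`. -/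
theorem exists_commutator_eq_diag {R : Type*} [CommRing R] (a b c : R) (hab : a * b = 1)
    (hc : (a ^ 2 - 1) * c = 1) :
    ∃ g k : SL(2, R), ((g⁻¹ * k * g * k⁻¹ : SL(2, R)) : Matrix (Fin 2) (Fin 2) R) =
      !![a, 0; 0, b] := by
  obtain ⟨e, he⟩ : ∃ e, e = c * (a - 1) := ⟨_, rfl⟩
  have hae : (a + 1) * e = 1 := by rw [he]; linear_combination hc
  -- With `e` inverse to `a + 1`, this `w` makes the common trace `a + b`: both matrices have
  -- characteristic roots `a`, `b`, whose difference is a unit, which leaves room for a conjugator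
  -- of determinant `1`.
  obtain ⟨w, hw⟩ : ∃ w, w = (a ^ 2 + 1) * e * b := ⟨_, rfl⟩
  have hd : (!![a, 0; 0, b] : Matrix (Fin 2) (Fin 2) R).det = 1 := by
    simp [Matrix.det_fin_two, hab]
  have hg : (!![w, 1 - a * w * w; -1, a * w] : Matrix (Fin 2) (Fin 2) R).det = 1 := by
    rw [Matrix.det_fin_two_of]; ring
  have hk : (!![-a * c * (1 - w * b - b + w), -a * c * ((1 - w * b) * (w - a) + (b - w) ^ 2);
      -a * e, -a * c * (a - w - 1 + a * w)] : Matrix (Fin 2) (Fin 2) R).det = 1 := by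
    rw [Matrix.det_fin_two_of]; grind
  let d : SL(2, R) := ⟨_, hd⟩
  let g : SL(2, R) := ⟨_, hg⟩
  let k : SL(2, R) := ⟨_, hk⟩
  have key : k * g = g * d * k := by
    apply Subtype.ext
    change !![_, _; _, _] * !![_, _; _, _] = !![_, _; _, _] * !![_, _; _, _] * !![_, _; _, _]
    simp only [Matrix.mul_fin_two]
    ext i j
    fin_cases i <;> fin_cases j <;> dsimp <;> grind
  refine ⟨g, k, ?_⟩
  have : g⁻¹ * k * g * k⁻¹ = d := by
    rw [mul_assoc g⁻¹, key]; group
  rw [this]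

/-! ### Involutions attached to elements of `SL₂(R)`. -/

theorem SL_mulVec_mulVec {R : Type*} [CommRing R] (m n : SL(2, R)) (x : Fin 2 → R) :
    m.1 *ᵥ (n.1 *ᵥ x) = (m * n : SL(2, R)).1 *ᵥ x :=
  Matrix.mulVec_mulVec _ _ _

theorem SL_one_mulVec {R : Type*} [CommRing R] (x : Fin 2 → R) :
    (1 : SL(2, R)).1 *ᵥ x = x :=
  Matrix.one_mulVec _

/-- The involution `(x, y) ↦ (m⁻¹ y, m x)` of `R² × R²` attached to `m ∈ SL₂(R)`. -/
def slSwap (F : Type*) {R : Type*} [Field F] [CommRing R] [Algebra F R] (m : SL(2, R)) :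
    ((Fin 2 → R) × (Fin 2 → R)) ≃ₗ[F] ((Fin 2 → R) × (Fin 2 → R)) where
  toFun w := ((m⁻¹ : SL(2, R)).1 *ᵥ w.2, m.1 *ᵥ w.1)
  map_add' w z := by simp [Matrix.mulVec_add]
  map_smul' c w := by simp [Matrix.mulVec_smul]
  invFun w := ((m⁻¹ : SL(2, R)).1 *ᵥ w.2, m.1 *ᵥ w.1)
  left_inv w := by
    simp only [SL_mulVec_mulVec, inv_mul_cancel, mul_inv_cancel, SL_one_mulVec]
  right_inv w := by
    simp only [SL_mulVec_mulVec, inv_mul_cancel, mul_inv_cancel, SL_one_mulVec]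

theorem slSwap_apply (F : Type*) {R : Type*} [Field F] [CommRing R] [Algebra F R] (m : SL(2, R))
    (w : (Fin 2 → R) × (Fin 2 → R)) :
    slSwap F m w = ((m⁻¹ : SL(2, R)).1 *ᵥ w.2, m.1 *ᵥ w.1) := rfl

/-- The standard symplectic pairing on `R²`. -/
def planePairing {R : Type*} [CommRing R] (x y : Fin 2 → R) : R := x 0 * y 1 - x 1 * y 0

theorem planePairing_mulVec {R : Type*} [CommRing R] (m : SL(2, R)) (x y : Fin 2 → R) :
    planePairing (m.1 *ᵥ x) (m.1 *ᵥ y) = planePairing x y := by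
  have h := m.2
  rw [Matrix.det_fin_two] at h
  simp only [planePairing, Matrix.mulVec, dotProduct, Fin.sum_univ_two]
  linear_combination (x 0 * y 1 - x 1 * y 0) * h

/-- The swaps attached to `g`, `k * g`, `k` multiply to `(x, y) ↦ (g⁻¹ k g k⁻¹ y, g (k g)⁻¹ k x)`,
and the second component is `x`. -/
theorem isReflectional_three_of_equiv {F V R : Type*} [Field F] [AddCommGroup V] [Module F V]
    [CommRing R] [Algebra F R] {s : LinearMap.BilinForm F V} (ψ : R →ₗ[F] F)
    (Φ : ((Fin 2 → R) × (Fin 2 → R)) ≃ₗ[F] V)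
    (hs : ∀ w z, s (Φ w) (Φ z) = ψ (planePairing w.1 z.1) + ψ (planePairing w.2 z.2))
    (u : Sp s) (g k : SL(2, R))
    (hu : ∀ x y, u.1 (Φ (x, y)) = Φ ((g⁻¹ * k * g * k⁻¹ : SL(2, R)).1 *ᵥ y, x)) :
    IsReflectional 3 u := by
  have hmem : ∀ m : SL(2, R), Φ.symm ≪≫ₗ slSwap F m ≪≫ₗ Φ ∈ Sp s := by
    intro m x y
    obtain ⟨w, rfl⟩ := Φ.surjective x
    obtain ⟨z, rfl⟩ := Φ.surjective y
    simp only [LinearEquiv.trans_apply, LinearEquiv.symm_apply_apply, hs, slSwap_apply,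
      planePairing_mulVec]
    ring
  let i : SL(2, R) → Sp s := fun m => ⟨_, hmem m⟩
  have hi : ∀ m w, (i m).1 (Φ w) = Φ (slSwap F m w) := fun m w => by simp [i]
  refine ⟨[i g, i (k * g), i k], rfl, ?_, ?_⟩
  · have hsq : ∀ m, i m * i m = 1 := by
      intro m
      apply Subtype.ext
      apply LinearEquiv.ext
      intro x
      obtain ⟨w, rfl⟩ := Φ.surjective x
      rw [Subgroup.coe_mul, LinearEquiv.mul_apply, hi, hi]
      exact congrArg Φ ((slSwap F m).left_inv w)
    simp [hsq]
  · apply Subtype.ext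
    apply LinearEquiv.ext
    intro x
    obtain ⟨⟨x, y⟩, rfl⟩ := Φ.surjective x
    simp only [List.prod_cons, List.prod_nil, mul_one]
    rw [Subgroup.coe_mul, Subgroup.coe_mul, LinearEquiv.mul_apply, LinearEquiv.mul_apply,
      hi, hi, hi, hu]
    simp only [slSwap_apply, SL_mulVec_mulVec]
    rw [show g * ((k * g)⁻¹ * k) = 1 by group, SL_one_mulVec]
    simp only [mul_assoc]

/-! ### Even polynomials and their quotient algebras. -/

/-- If `a` is a root of `p` with `a ^ 4 = 1`, then `a⁻¹` is `a` or `-a`, again a root by evenness;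
so `a` is also a root of the reciprocal polynomial. -/
theorem isCoprime_X_pow_four_sub_one {F : Type*} [Field F] {p : F[X]} (hp : IsEvenPoly p)
    (hcop : IsCoprime p (reciprocalPoly p)) : IsCoprime p (X ^ 4 - 1) := by
  rw [isCoprime_iff_aeval_ne_zero_of_isAlgClosed F (AlgebraicClosure F)] at hcop ⊢
  intro a
  by_contra! h
  obtain ⟨h1, h2⟩ := h
  have ha : a ^ 4 = 1 := by simpa [sub_eq_zero] using h2
  have ha0 : a ≠ 0 := by rintro rfl; simp at ha
  have hneg : aeval (-a) p = 0 := by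
    have : aeval a (p.comp (-X)) = 0 := by rw [hp]; exact h1
    simpa [aeval_comp] using this
  have hinv : aeval a⁻¹ p = 0 := by
    have : (a ^ 2 - 1) * (a ^ 2 + 1) = 0 := by linear_combination ha
    rcases mul_eq_zero.mp this with h | h
    · rw [inv_eq_of_mul_eq_one_left (show a * a = 1 by linear_combination h)]
      exact h1
    · rw [show a⁻¹ = -a from (eq_inv_of_mul_eq_one_left (by linear_combination -h)).symm]
      exact hneg
  rcases hcop a with h | h
  · exact h h1
  · apply h
    let _ := invertibleOfNonzero (inv_ne_zero ha0)
    have := (eval₂_reverse_eq_zero_iff (algebraMap F (AlgebraicClosure F)) a⁻¹ p).mpr hinv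
    rw [invOf_eq_inv, inv_inv] at this
    simp [reciprocalPoly, aeval_def, this]

theorem coeff_comp_neg_X {F : Type*} [Field F] (f : F[X]) (n : ℕ) :
    (f.comp (-X)).coeff n = (-1) ^ n * f.coeff n := by
  rw [show (-X : F[X]) = C (-1) * X by simp, comp_C_mul_X_coeff, mul_comm]

/-- Substituting `-X` fixes `p` and preserves degrees, so uniqueness of Euclidean division applies.
Hence remainders keep the parity of the dividend. -/
theorem modByMonic_comp_neg_X {F : Type*} [Field F] {p : F[X]} (hp : IsEvenPoly p)
    (hm : p.Monic) (f : F[X]) : (f.comp (-X)) %ₘ p = (f %ₘ p).comp (-X) := by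
  have hdeg : ((f %ₘ p).comp (-X)).degree < p.degree := by
    rw [degree_comp_neg_X]
    exact degree_modByMonic_lt _ hm
  refine (div_modByMonic_unique ((f /ₘ p).comp (-X)) _ hm ⟨?_, hdeg⟩).2
  conv_rhs => rw [← modByMonic_add_div f p, add_comp, mul_comp]
  rw [hp]

theorem IsEvenPoly.even_natDegree {F : Type*} [Field F] (h2 : (2 : F) ≠ 0) {p : F[X]}
    (hp : IsEvenPoly p) (h0 : p ≠ 0) : Even p.natDegree := by
  by_contra h
  rw [Nat.not_even_iff_odd] at h
  have := congrArg (fun q => coeff q p.natDegree) hp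
  simp only [coeff_comp_neg_X, h.neg_one_pow] at this
  apply h0
  rw [← leadingCoeff_eq_zero, leadingCoeff]
  have : (2 : F) * p.coeff p.natDegree = 0 := by linear_combination -this
  simpa [h2] using this

/-- The even part of the quotient algebra by an even polynomial carries a nondegenerate trace form
whose linear form vanishes on the odd part. -/
theorem exists_even_functional {F : Type*} [Field F] (h2 : (2 : F) ≠ 0) {p : F[X]}
    (hp : IsEvenPoly p) (hm : p.Monic) :
    ∃ l : F[X] →ₗ[F] F, (∀ f, p ∣ f → l f = 0) ∧ (∀ f : F[X], l (X * f.comp (X ^ 2)) = 0) ∧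
      ∀ f : F[X], (∀ g : F[X], l (f.comp (X ^ 2) * g.comp (X ^ 2)) = 0) → p ∣ f.comp (X ^ 2) := by
  have hev := hp.even_natDegree h2 hm.ne_zero
  have hsq : ∀ f : F[X], (f.comp (X ^ 2)).comp (-X) = f.comp (X ^ 2) := by
    intro f
    rw [comp_assoc]
    simp
  -- The degree of `p` is even, so this index is the top possible degree of a nonzero even
  -- remainder. For `p = 1` the truncated subtraction is harmless, as all remainders vanish.
  refine ⟨lcoeff F (p.natDegree - 2) ∘ₗ modByMonicHom p, ?_, ?_, ?_⟩
  · intro f hf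
    simp [(modByMonic_eq_zero_iff_dvd hm).mpr hf]
  · intro f
    have h := modByMonic_comp_neg_X hp hm (X * f.comp (X ^ 2))
    rw [mul_comp, hsq, X_comp, neg_mul, neg_modByMonic] at h
    have h' := congrArg (fun q => coeff q (p.natDegree - 2)) h
    simp only [coeff_comp_neg_X, (hev.tsub even_two).neg_one_pow, coeff_neg] at h'
    have : (2 : F) * (X * f.comp (X ^ 2) %ₘ p).coeff (p.natDegree - 2) = 0 := by
      linear_combination -h'
    simpa [h2] using this
  · intro f hf
    rw [← modByMonic_eq_zero_iff_dvd hm]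
    by_contra h0
    obtain ⟨ρ, hρ⟩ : ∃ ρ, ρ = f.comp (X ^ 2) %ₘ p := ⟨_, rfl⟩
    rw [← hρ] at h0
    have hρe : IsEvenPoly ρ := by
      rw [IsEvenPoly, hρ, ← modByMonic_comp_neg_X hp hm, hsq]
    have hρn := hρe.even_natDegree h2 h0
    have hlt : ρ.natDegree < p.natDegree := by
      apply natDegree_lt_natDegree h0
      rw [hρ]
      exact degree_modByMonic_lt _ hm
    obtain ⟨i, hi⟩ := hev
    obtain ⟨j, hj⟩ := hρn
    -- Multiplying by this even monomial moves the leading coefficient of `ρ` to degree `p.natDegree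
    -- - 2`, with no reduction modulo `p`.
    have h := hf (X ^ (i - 1 - j))
    have hdeg : (ρ * X ^ (2 * (i - 1 - j))).degree < p.degree := by
      rw [degree_mul, degree_X_pow, degree_eq_natDegree h0, degree_eq_natDegree hm.ne_zero]
      norm_cast
      omega
    have hmod : (f.comp (X ^ 2) * X ^ (2 * (i - 1 - j))) %ₘ p = ρ * X ^ (2 * (i - 1 - j)) := by
      refine (div_modByMonic_unique ((f.comp (X ^ 2) /ₘ p) * X ^ (2 * (i - 1 - j))) _ hm
        ⟨?_, hdeg⟩).2
      conv_rhs => rw [← modByMonic_add_div (f.comp (X ^ 2)) p]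
      rw [hρ]
      ring
    rw [X_pow_comp, ← pow_mul, LinearMap.comp_apply, modByMonicHom_apply, hmod, lcoeff_apply,
      show p.natDegree - 2 = ρ.natDegree + 2 * (i - 1 - j) by omega, coeff_mul_X_pow] at h
    exact h0 (leadingCoeff_eq_zero.mp h)

/-! ### Coordinates on `V` adapted to the symplectic extension. -/

theorem apply_toDualLagrangian_symm {F V : Type*} [Field F] [AddCommGroup V] [Module F V]
    [FiniteDimensional F V] {s : LinearMap.BilinForm F V} {L L' : Submodule F V}
    (hs : IsSymplecticForm s) (hL : IsLagrangian s L) (hL' : IsLagrangian s L')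
    (h : L ⊓ L' = ⊥) (f : Module.Dual F L) (l : L) :
    s l ((toDualLagrangian hs hL hL' h).symm f) = f l :=
  LinearMap.congr_fun ((toDualLagrangian hs hL hL' h).apply_symm_apply f) l

theorem symplecticExtension_apply_add_symm {F V : Type*} [Field F] [AddCommGroup V] [Module F V]
    [FiniteDimensional F V] {s : LinearMap.BilinForm F V} {L L' : Submodule F V}
    (hs : IsSymplecticForm s) (hL : IsLagrangian s L) (hL' : IsLagrangian s L')
    (h : L ⊓ L' = ⊥) (v : L ≃ₗ[F] L) (l : L) (f : Module.Dual F L) :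
    (symplecticExtension hs hL hL' h v).1 (l + (toDualLagrangian hs hL hL' h).symm f) =
      v l + (toDualLagrangian hs hL hL' h).symm (f ∘ₗ (v.symm : L →ₗ[F] L)) := by
  have e : contragredient hs hL hL' h v ((toDualLagrangian hs hL hL' h).symm f) =
      (toDualLagrangian hs hL hL' h).symm (f ∘ₗ (v.symm : L →ₗ[F] L)) := by
    simp only [contragredient, LinearEquiv.trans_apply, LinearEquiv.apply_symm_apply]
    rfl
  rw [← e]
  exact symplecticExtensionEquiv_apply hs hL hL' h v _ _

theorem isSymplecticForm_apply_add_add {F V : Type*} [Field F] [AddCommGroup V] [Module F V]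
    [FiniteDimensional F V] {s : LinearMap.BilinForm F V} {L L' : Submodule F V}
    (hs : IsSymplecticForm s) (hL : IsLagrangian s L) (hL' : IsLagrangian s L')
    (h : L ⊓ L' = ⊥) (l m : L) (f g : Module.Dual F L) :
    s (l + (toDualLagrangian hs hL hL' h).symm f) (m + (toDualLagrangian hs hL hL' h).symm g) =
      g l - f m := by
  simp only [map_add, LinearMap.add_apply]
  rw [hL.singular _ l.2 _ m.2, hL'.singular _ (SetLike.coe_mem _) _ (SetLike.coe_mem _),
    apply_toDualLagrangian_symm, ← hs.alt.neg_eq, apply_toDualLagrangian_symm]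
  ring

/-- Coordinates in which a symplectic extension becomes an operator on `R² × R²`. -/
theorem exists_equiv_of_functional {F V R : Type*} [Field F] [AddCommGroup V] [Module F V]
    [FiniteDimensional F V] {s : LinearMap.BilinForm F V} {L L' : Submodule F V}
    (hs : IsSymplecticForm s) (hL : IsLagrangian s L) (hL' : IsLagrangian s L')
    (h : L ⊓ L' = ⊥) (v : L ≃ₗ[F] L) [CommRing R] [Algebra F R] [FiniteDimensional F R]
    (ι : R →ₐ[F] Module.End F L) (a b : R) (hab : a * b = 1)
    (ha : ∀ l, ι a l = v (v l)) (hcomm : ∀ x l, ι x (v l) = v (ι x l))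
    (e : L) (l : Module.Dual F L)
    (hspan : ∀ m : L, ∃ x y : R, ι x e + v (ι y e) = m)
    (hodd : ∀ x, l (v (ι x e)) = 0) (hnd : ∀ x, (∀ z, l (ι (x * z) e) = 0) → x = 0) :
    ∃ (ψ : R →ₗ[F] F) (Φ : ((Fin 2 → R) × (Fin 2 → R)) ≃ₗ[F] V),
      (∀ w z, s (Φ w) (Φ z) = ψ (planePairing w.1 z.1) + ψ (planePairing w.2 z.2)) ∧
      ∀ x y, (symplecticExtension hs hL hL' h v).1 (Φ (x, y)) =
        Φ (!![a, 0; 0, b] *ᵥ y, x) := by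
  have hb : ∀ m, ι b m = v.symm (v.symm m) := by
    intro m
    apply v.injective
    apply v.injective
    rw [← ha, ← Module.End.mul_apply, ← map_mul, hab, map_one]
    simp
  have hcomm' : ∀ x m, ι x (v.symm m) = v.symm (ι x m) := by
    intro x m
    apply v.injective
    rw [← hcomm]
    simp
  have hodd' : ∀ x, l (v.symm (ι x e)) = 0 := by
    intro x
    have := hodd (b * x)
    rw [map_mul, Module.End.mul_apply, hb] at this
    simpa using this
  let ψ : R →ₗ[F] F := l ∘ₗ LinearMap.applyₗ e ∘ₗ ι.toLinearMap
  have hψ : ∀ x, ψ x = l (ι x e) := fun x => rfl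
  let P : ((Fin 2 → R) × (Fin 2 → R)) →ₗ[F] L :=
    { toFun := fun w => ι (w.1 0) e + v (ι (w.2 0) e)
      map_add' := fun w z => by simp; abel
      map_smul' := fun c w => by simp }
  -- The twist by `v⁻¹` in the second plane is the action of `u` on functionals, so `u` carries the
  -- first plane to the second with unchanged coordinates. Cross terms against `P` are values of `l`
  -- on odd vectors, so the planes are orthogonal.
  let Q : ((Fin 2 → R) × (Fin 2 → R)) →ₗ[F] Module.Dual F L :=
    { toFun := fun w => l ∘ₗ ι (w.1 1) + l ∘ₗ ι (w.2 1) ∘ₗ (v.symm : L →ₗ[F] L)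
      map_add' := fun w z => by ext; simp; ring
      map_smul' := fun c w => by ext; simp }
  let φ := toDualLagrangian hs hL hL' h
  let Φ : ((Fin 2 → R) × (Fin 2 → R)) →ₗ[F] V :=
    L.subtype ∘ₗ P + L'.subtype ∘ₗ (φ.symm : Module.Dual F L →ₗ[F] L') ∘ₗ Q
  have hΦ : ∀ w, Φ w = P w + φ.symm (Q w) := fun w => rfl
  have hP : ∀ w, P w = ι (w.1 0) e + v (ι (w.2 0) e) := fun w => rfl
  have hQ : ∀ w m, Q w m = l (ι (w.1 1) m) + l (v.symm (ι (w.2 1) m)) := fun w m => by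
    rw [← hcomm']; rfl
  have hQP : ∀ w z, Q w (P z) = ψ (w.1 1 * z.1 0) + ψ (w.2 1 * z.2 0) := by
    intro w z
    rw [hQ, hP]
    simp only [map_add, hcomm, LinearEquiv.symm_apply_apply, hψ, ← Module.End.mul_apply,
      ← map_mul, hodd, hodd']
    ring
  have hform : ∀ w z, s (Φ w) (Φ z) = ψ (planePairing w.1 z.1) + ψ (planePairing w.2 z.2) := by
    intro w z
    rw [hΦ, hΦ, isSymplecticForm_apply_add_add, hQP, hQP]
    simp only [planePairing, map_sub, mul_comm]
    ring
  have hinj : Function.Injective Φ := by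
    rw [← LinearMap.ker_eq_bot, LinearMap.ker_eq_bot']
    intro w hw
    have h0 : ∀ z : (Fin 2 → R) × (Fin 2 → R), ψ (planePairing w.1 z.1) + ψ (planePairing w.2 z.2) = 0 := fun z => by
      rw [← hform, hw, map_zero, LinearMap.zero_apply]
    have h1 : w.1 0 = 0 := hnd _ fun z => by
      have := h0 (![0, z], 0)
      simpa [planePairing, hψ] using this
    have h2 : w.1 1 = 0 := hnd _ fun z => by
      have := h0 (![z, 0], 0)
      simpa [planePairing, hψ] using this
    have h3 : w.2 0 = 0 := hnd _ fun z => by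
      have := h0 (0, ![0, z])
      simpa [planePairing, hψ] using this
    have h4 : w.2 1 = 0 := hnd _ fun z => by
      have := h0 (0, ![z, 0])
      simpa [planePairing, hψ] using this
    ext i <;> fin_cases i <;> assumption
  have hsurj : Function.Surjective ((LinearMap.applyₗ e ∘ₗ ι.toLinearMap).coprod
      ((v : L →ₗ[F] L) ∘ₗ LinearMap.applyₗ e ∘ₗ ι.toLinearMap)) := by
    intro m
    obtain ⟨x, y, hxy⟩ := hspan m
    exact ⟨(x, y), hxy⟩
  have hdim : Module.finrank F ((Fin 2 → R) × (Fin 2 → R)) = Module.finrank F V := by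
    -- Conversely, `hspan` bounds `dim L` by `2 dim R`, hence `dim V` by `4 dim R`.
    apply le_antisymm (LinearMap.finrank_le_finrank_of_injective hinj)
    have h1 := LinearMap.finrank_le_finrank_of_surjective hsurj
    have h2 := hL.finrank_eq
    rw [Module.finrank_prod] at h1
    rw [Module.finrank_prod, Module.finrank_pi_fintype]
    simp only [Finset.sum_const, Finset.card_univ, Fintype.card_fin, smul_eq_mul]
    omega
  refine ⟨ψ, LinearEquiv.ofInjectiveOfFinrankEq Φ hinj hdim, hform, ?_⟩
  intro x y
  change (symplecticExtension hs hL hL' h v).1 (Φ (x, y)) = Φ (!![a, 0; 0, b] *ᵥ y, x)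
  rw [hΦ, hΦ, symplecticExtension_apply_add_symm]
  congr 3
  · simp [hP, dotProduct, Fin.sum_univ_two, ha, add_comm]
  · refine LinearMap.ext fun m => ?_
    rw [LinearMap.comp_apply, hQ, hQ]
    simp [Matrix.mulVec, dotProduct, Fin.sum_univ_two, hb, hcomm', add_comm]

/-! ### The algebra generated by `v ^ 2` and the conclusion. -/

/-- Injectivity makes `x` a non-zero-divisor, and in an Artinian ring these are units. -/
theorem isUnit_of_isUnit_map_of_injective {F R A : Type*} [Field F] [CommRing R] [Algebra F R]
    [FiniteDimensional F R] [Ring A] [Algebra F A] (ι : R →ₐ[F] A) (hι : Function.Injective ι)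
    {x : R} (hx : IsUnit (ι x)) : IsUnit x := by
  have : IsArtinianRing R := IsArtinianRing.of_finite F R
  apply IsArtinianRing.isUnit_of_mem_nonZeroDivisors
  rw [mem_nonZeroDivisors_iff_right]
  intro y hy
  apply hι
  rw [map_zero, ← hx.mul_left_eq_zero, ← map_mul, hy, map_zero]

theorem surjective_aeval_apply_of_span_eq_top {F W : Type*} [Field F] [AddCommGroup W] [Module F W]
    (f : Module.End F W) (x : W) (h : Submodule.span F (Set.range fun k : ℕ => (f ^ k) x) = ⊤) :
    Function.Surjective (LinearMap.applyₗ x ∘ₗ (aeval f : F[X] →ₐ[F] _).toLinearMap) := by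
  rw [← LinearMap.range_eq_top, eq_top_iff, ← h, Submodule.span_le]
  rintro _ ⟨k, rfl⟩
  exact ⟨X ^ k, by simp⟩

theorem exists_even_add_X_mul_even {F : Type*} [Field F] (f : F[X]) :
    ∃ g h : F[X], f = g.comp (X ^ 2) + X * h.comp (X ^ 2) := by
  induction f using Polynomial.induction_on' with
  | add p q hp hq =>
    obtain ⟨g, h, rfl⟩ := hp
    obtain ⟨g', h', rfl⟩ := hq
    exact ⟨g + g', h + h', by simp only [add_comp]; ring⟩
  | monomial n c =>
    rw [← C_mul_X_pow_eq_monomial]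
    obtain ⟨k, rfl | rfl⟩ := n.even_or_odd'
    · exact ⟨C c * X ^ k, 0, by simp [pow_mul]⟩
    · exact ⟨0, C c * X ^ k, by simp [pow_mul, pow_succ]; ring⟩

theorem mainTheorem6 {F V : Type*} [Field F] (hF : ringChar F ≠ 2)
    [AddCommGroup V] [Module F V] [FiniteDimensional F V]
    (s : LinearMap.BilinForm F V) (hs : IsSymplecticForm s) (u : Sp s)
    (L L' : Submodule F V) (hL : IsLagrangian s L) (hL' : IsLagrangian s L')
    (hLL' : L ⊓ L' = ⊥) (v : L ≃ₗ[F] L)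
    (hu : u = symplecticExtension hs hL hL' hLL' v)
    (hcyc : IsCyclicEnd (v : L →ₗ[F] L))
    (heven : IsEvenPoly (minpoly F (v : L →ₗ[F] L)))
    (hcop : IsCoprime (minpoly F (v : L →ₗ[F] L)) (reciprocalPoly (minpoly F (v : L →ₗ[F] L)))) :
    IsReflectional 3 u := by
  have h2 : (2 : F) ≠ 0 := Ring.two_ne_zero hF
  obtain ⟨e, he⟩ := hcyc
  obtain ⟨T, hT⟩ : ∃ T : Module.End F L, T = (v : L →ₗ[F] L) := ⟨_, rfl⟩
  rw [← hT] at he heven hcop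
  have hTv : ∀ m, T m = v m := fun m => by rw [hT]; rfl
  have hm : (minpoly F T).Monic := minpoly.monic (Algebra.IsIntegral.isIntegral T)
  obtain ⟨l₀, hl₀, hodd, hnd⟩ := exists_even_functional h2 heven hm
  have hsurj := surjective_aeval_apply_of_span_eq_top T e he
  have hker : ∀ f : F[X], aeval T f e = 0 → minpoly F T ∣ f := by
    intro f hf
    apply minpoly.dvd
    ext m
    obtain ⟨g, rfl⟩ := hsurj m
    change ((aeval T f (aeval T g e) : L) : V) = 0
    rw [← Module.End.mul_apply, ← map_mul, mul_comm, map_mul, Module.End.mul_apply, hf, map_zero]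
    rfl
  -- A linear section of `f ↦ f(T) e` transports `l₀` to `L`; its choice is immaterial because `l₀`
  -- kills the multiples of the minimal polynomial.
  obtain ⟨σ, hσ⟩ := LinearMap.exists_rightInverse_of_surjective _
    (LinearMap.range_eq_top.mpr hsurj)
  have hl : ∀ f, (l₀ ∘ₗ σ) (aeval T f e) = l₀ f := by
    intro f
    rw [LinearMap.comp_apply, ← sub_eq_zero, ← map_sub]
    apply hl₀
    apply hker
    rw [map_sub, LinearMap.sub_apply, sub_eq_zero]
    exact LinearMap.congr_fun hσ _
  have hsq : ∀ f : F[X], aeval (T ^ 2) f = aeval T (f.comp (X ^ 2)) := fun f => by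
    rw [aeval_comp]; simp
  let π : F[X] →ₐ[F] F[X] ⧸ RingHom.ker (aeval (R := F) (T ^ 2)) := Ideal.Quotient.mkₐ F _
  have hπ : Function.Surjective π := Ideal.Quotient.mkₐ_surjective F _
  let ι := Ideal.kerLiftAlg (aeval (R := F) (T ^ 2))
  have hι : Function.Injective ι := Ideal.kerLiftAlg_injective _
  have hιπ : ∀ f, ι (π f) = aeval T (f.comp (X ^ 2)) := fun f => by
    rw [← hsq]; exact Ideal.kerLiftAlg_mk _ f
  have : FiniteDimensional F (F[X] ⧸ RingHom.ker (aeval (R := F) (T ^ 2))) :=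
    FiniteDimensional.of_injective ι.toLinearMap hι
  have hιX : ι (π X) = T ^ 2 := by rw [hιπ]; simp
  have hTunit : IsUnit T := by
    rw [hT]
    exact (Module.End.isUnit_iff _).mpr v.bijective
  obtain ⟨b, hb⟩ := (isUnit_of_isUnit_map_of_injective ι hι
    (x := π X) (by rw [hιX]; exact hTunit.pow 2)).exists_right_inv
  obtain ⟨c, hc⟩ := (isUnit_of_isUnit_map_of_injective ι hι (x := π X ^ 2 - 1) (by
    -- Evaluating the Bézout relation at `T` kills the first term, so `B(T)` is inverse to `T ^ 4 -
    -- 1`.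
    obtain ⟨A, B, hAB⟩ := isCoprime_X_pow_four_sub_one heven hcop
    have h := congrArg (aeval T) hAB
    rw [map_add, map_mul, minpoly.aeval, mul_zero, zero_add, map_one] at h
    rw [map_sub, map_pow, hιX, map_one, ← pow_mul]
    have h' := h
    rw [mul_comm, map_mul] at h'
    rw [map_mul] at h
    have hX : aeval T (X ^ 4 - 1 : F[X]) = T ^ (2 * 2) - 1 := by simp
    rw [hX] at h h'
    exact ⟨⟨_, _, h', h⟩, rfl⟩)).exists_right_inv
  obtain ⟨g, k, hgk⟩ := exists_commutator_eq_diag (π X) b c hb hc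
  have hcomm : ∀ x m, ι x (v m) = v (ι x m) := by
    intro x m
    obtain ⟨f, rfl⟩ := hπ x
    rw [hιπ, ← hTv, ← hTv, ← Module.End.mul_apply, ← Module.End.mul_apply]
    congr 1
    simpa using congrArg (aeval T) (mul_comm (f.comp (X ^ 2)) X)
  have hspan : ∀ m : L, ∃ x y, ι x e + v (ι y e) = m := by
    intro m
    obtain ⟨f, rfl⟩ := hsurj m
    obtain ⟨g, h, rfl⟩ := exists_even_add_X_mul_even f
    refine ⟨π g, π h, ?_⟩
    rw [hιπ, hιπ, ← hTv]
    simp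
  have hl_odd : ∀ x, (l₀ ∘ₗ σ) (v (ι x e)) = 0 := by
    intro x
    obtain ⟨f, rfl⟩ := hπ x
    rw [hιπ, ← hTv, ← hodd f, ← hl]
    simp
  have hl_nd : ∀ x, (∀ z, (l₀ ∘ₗ σ) (ι (x * z) e) = 0) → x = 0 := by
    intro x hx
    obtain ⟨f, rfl⟩ := hπ x
    apply hι
    rw [map_zero, hιπ]
    rw [← minpoly.dvd_iff]
    apply hnd
    intro g
    rw [← hx (π g), ← map_mul, hιπ, hl, mul_comp]
  obtain ⟨ψ, Φ, hform, hΦ⟩ := exists_equiv_of_functional hs hL hL' hLL' v ι (π X) b hb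
    (fun m => by rw [hιX, pow_two, Module.End.mul_apply, hTv, hTv]) hcomm e (l₀ ∘ₗ σ)
    hspan hl_odd hl_nd
  subst hu
  exact isReflectional_three_of_equiv ψ Φ hform _ g k (fun x y => by rw [hΦ, hgk])
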